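/- Let $m$ be a natural number, let $V_1,V_2\in\mathbb{R}^{m\times m}$ be orthogonal matrices, let $\alpha_1,\alpha_2\in\mathbb{R}^m$, and put $$N(\alpha)=V_1^T\,\mathrm{diag}(\alpha_1)\,V_1\,V_2^T\,\mathrm{diag}(\alpha_2)\,V_2 .$$ For $i=1,2$ let $0\le\underline{n}_i\le\overline{n}_i$ and $0\le\underline{p}_i\le\overline{p}_i$ be real numbers such that $$\alpha_{i,j}\in[-\overline{n}_i,-\underline{n}_i]\cup[\underline{p}_i,\overline{p}_i]\qquad\text{for all } j=1,\dots,m .$$ Define $$\overline{n}=\max(\overline{p}_1\overline{n}_2,\overline{n}_1\overline{p}_2),\quad \overline{p}=\max(\overline{p}_1\overline{p}_2,\overline{n}_1\overline{n}_2),\quad \overline{r}=\sqrt{\overline{p}_1\overline{p}_2\overline{n}_1\overline{n}_2},$$ $$\underline{n}=\min(\underline{p}_1\underline{n}_2,\underline{n}_1\underline{p}_2),\quad \underline{p}=\min(\underline{p}_1\underline{p}_2,\underline{n}_1\underline{n}_2),\quad \underline{r}=\sqrt{\underline{p}_1\underline{p}_2\underline{n}_1\underline{n}_2}.$$ Then $0\le\underline{n}\le\underline{r}\le\overline{r}\le\overline{n}$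 and $0\le\underline{p}\le\underline{r}\le\overline{r}\le\overline{p}$. Every real eigenvalue $\lambda$ of $N(\alpha)$ satisfies $$\lambda\in[-\overline{n},-\underline{n}]\cup[\underline{p},\overline{p}],$$ and every non-real complex eigenvalue $\lambda$ of $N(\alpha)$ satisfies $$\underline{r}\le|\lambda|\le\overline{r}.$$ -/

import Mathlib

/-- The real matrix `N(α) = V₁ᵀ diag(α₁) V₁ V₂ᵀ diag(α₂) V₂`. -/
def iterationMatrix {ι : Type*} [Fintype ι] [DecidableEq ι]
    (V₁ V₂ : Matrix ι ι ℝ) (α₁ α₂ : ι → ℝ) : Matrix ι ι ℝ :=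
  V₁.transpose * Matrix.diagonal α₁ * V₁ * V₂.transpose * Matrix.diagonal α₂ * V₂

/-- `z` is an eigenvalue of the real square matrix `A`, acting on complex vectors. -/
def IsMatrixEigenvalue {ι : Type*} [Fintype ι] [DecidableEq ι]
    (A : Matrix ι ι ℝ) (z : ℂ) : Prop :=
  Module.End.HasEigenvalue (Matrix.toLin' (A.map (fun t : ℝ => (t : ℂ)))) z

/-! Write `N = A₁A₂` with `Aᵢ = Vᵢᵀ diag(αᵢ) Vᵢ` symmetric. If `Nx = zx` and `y = A₂x`, then `A₁y =
zx`. Put `X = |x|²`, `t = ⟨y,x⟩`, `Y = |y|²`, `s = ⟨y,A₁y⟩ = zt`; symmetry makes `t` and `s` real.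
The spectral intervals give linear inequalities: between `X`, `t`, `Y` for `A₂`, and between `Y`,
`s`, `|z|²X` for `A₁`. For non-real `z`, `s = zt` forces `t = s = 0`, and the inequalities chain to
the bounds on `|z|`. For real `z`, eliminating `Y` (outer bounds) or `X` (inner gap) leaves a form
that is linear in the rest, so its sign is decided on the extreme rays, where it factors. -/

open Matrix in
/-- The squared moduli of the coordinates of a vector in an orthonormal eigenbasis of the symmetric
matrix `Vᵀ diag(α) V` represent its quadratic form and its square. -/
lemma exists_spectral_weights {ι : Type*} [Fintype ι] [DecidableEq ι]
    (V : Matrix ι ι ℝ) (hV : V ∈ Matrix.orthogonalGroup ι ℝ) (α : ι → ℝ) (x y : ι → ℂ)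
    (hy : (V.transpose * Matrix.diagonal α * V).map Complex.ofRealHom *ᵥ x = y) :
    ∃ w : ι → ℝ, (∀ j, 0 ≤ w j) ∧ star x ⬝ᵥ x = ((∑ j, w j : ℝ) : ℂ) ∧
      star y ⬝ᵥ x = ((∑ j, α j * w j : ℝ) : ℂ) ∧
      star y ⬝ᵥ y = ((∑ j, α j ^ 2 * w j : ℝ) : ℂ) := by
  set W : Matrix ι ι ℂ := V.map Complex.ofRealHom with hW
  have hWt : (V.transpose).map Complex.ofRealHom = Wᴴ := by
    ext i j; simp [hW]
  have hVV : V.transpose * V = 1 := (Matrix.mem_orthogonalGroup_iff' ι ℝ).1 hV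
  have hVV' : V * V.transpose = 1 := (Matrix.mem_orthogonalGroup_iff ι ℝ).1 hV
  have hWW : Wᴴ * W = 1 := by
    rw [← hWt, hW, ← Matrix.map_mul, hVV]; ext i j; simp [Matrix.one_apply, apply_ite]
  have hWW' : W * Wᴴ = 1 := by
    rw [← hWt, hW, ← Matrix.map_mul, hVV']; ext i j; simp [Matrix.one_apply, apply_ite]
  have hiso : ∀ u v : ι → ℂ, star (W *ᵥ u) ⬝ᵥ (W *ᵥ v) = star u ⬝ᵥ v := by
    intro u v
    rw [Matrix.star_mulVec, Matrix.dotProduct_mulVec, Matrix.vecMul_vecMul, hWW, Matrix.vecMul_one]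
  have hWy : ∀ j, (W *ᵥ y) j = (α j : ℂ) * (W *ᵥ x) j := by
    intro j
    have hd : (Matrix.diagonal α).map Complex.ofRealHom
        = Matrix.diagonal (fun i => (α i : ℂ)) := by
      rw [Matrix.diagonal_map (map_zero _)]; rfl
    rw [← hy, Matrix.map_mul, Matrix.map_mul, hWt, hd, Matrix.mulVec_mulVec, ← hW,
      ← Matrix.mul_assoc, ← Matrix.mul_assoc, hWW', Matrix.one_mul, ← Matrix.mulVec_mulVec,
      Matrix.mulVec_diagonal]
  refine ⟨fun j => Complex.normSq ((W *ᵥ x) j), fun j => Complex.normSq_nonneg _, ?_, ?_, ?_⟩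
  · rw [← hiso, dotProduct, Complex.ofReal_sum]
    refine Finset.sum_congr rfl fun j _ => ?_
    rw [Complex.normSq_eq_conj_mul_self]; rfl
  · rw [← hiso, dotProduct, Complex.ofReal_sum]
    refine Finset.sum_congr rfl fun j _ => ?_
    rw [Pi.star_apply, hWy, Complex.ofReal_mul, Complex.normSq_eq_conj_mul_self]
    simp [mul_assoc]
  · rw [← hiso, dotProduct, Complex.ofReal_sum]
    refine Finset.sum_congr rfl fun j _ => ?_
    rw [Pi.star_apply, hWy, Complex.ofReal_mul, Complex.normSq_eq_conj_mul_self]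
    simp only [star_mul', Complex.star_def, Complex.conj_ofReal, Complex.ofReal_pow]
    ring

open Matrix in
/-- Quadratic bounds for a symmetric matrix whose spectrum lies in a union of two intervals. -/
lemma exists_quadratic_bounds {ι : Type*} [Fintype ι] [DecidableEq ι]
    (V : Matrix ι ι ℝ) (hV : V ∈ Matrix.orthogonalGroup ι ℝ) (α : ι → ℝ)
    (nU nL pU pL : ℝ) (hnL : 0 ≤ nL) (hn : nL ≤ nU) (hpL : 0 ≤ pL) (hp : pL ≤ pU)
    (hα : ∀ j, α j ∈ Set.Icc (-nU) (-nL) ∪ Set.Icc pL pU) (x y : ι → ℂ)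
    (hy : (V.transpose * Matrix.diagonal α * V).map Complex.ofRealHom *ᵥ x = y) :
    ∃ X t Y : ℝ, star x ⬝ᵥ x = X ∧ star y ⬝ᵥ x = t ∧ star x ⬝ᵥ y = t ∧ star y ⬝ᵥ y = Y ∧
      0 ≤ Y ∧ -nU * X ≤ t ∧ t ≤ pU * X ∧ pL * t ≤ Y ∧ -nL * t ≤ Y ∧
      Y ≤ (pU - nU) * t + pU * nU * X ∧ (pL - nL) * t + pL * nL * X ≤ Y := by
  obtain ⟨w, hw, h1, h2, h3⟩ := exists_spectral_weights V hV α x y hy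
  have h2' : star x ⬝ᵥ y = ((∑ j, α j * w j : ℝ) : ℂ) := by
    rw [← Complex.conj_ofReal, ← h2, ← Complex.star_def, Matrix.star_dotProduct]
  -- Each inequality holds weight by weight; the last two are `(α - pU)(α + nU) ≤ 0` and `(α - pL)(α
  -- + nL) ≥ 0`.
  refine ⟨_, _, _, h1, h2, h2', h3, Finset.sum_nonneg fun j _ => mul_nonneg (sq_nonneg _) (hw j),
    ?_, ?_, ?_, ?_, ?_, ?_⟩ <;>
  simp only [Finset.mul_sum, ← Finset.sum_add_distrib] <;>
  refine Finset.sum_le_sum fun j _ => ?_ <;>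
  (try simp only [← mul_assoc, ← add_mul]) <;>
  refine mul_le_mul_of_nonneg_right ?_ (hw j) <;>
  rcases hα j with ⟨ha, hb⟩ | ⟨ha, hb⟩ <;>
  first | linarith | nlinarith

/-- A convex combination of positive numbers, cleared of denominators. -/
lemma pos_combination {a b u v : ℝ} (ha : 0 < a) (hb : 0 < b) (hu : 0 ≤ u) (hv : 0 ≤ v)
    (huv : 0 < u + v) : 0 < a * u + b * v := by
  rcases hu.eq_or_lt with rfl | hu
  · have : 0 < v := by linarith
    positivity
  · positivity

/-- The upper spectral bounds: no real eigenvalue lies outside the outer interval. -/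
lemma not_outside_upper {l X t Y p₁ n₁ p₂ n₂ : ℝ} (hX : 0 < X)
    (hp₁ : 0 ≤ p₁) (hn₁ : 0 ≤ n₁) (hp₂ : 0 ≤ p₂) (hn₂ : 0 ≤ n₂)
    (h1 : -n₂ * X ≤ t) (h2 : t ≤ p₂ * X)
    (hY : Y ≤ (p₂ - n₂) * t + p₂ * n₂ * X)
    (hZ : l ^ 2 * X ≤ (p₁ - n₁) * (l * t) + p₁ * n₁ * Y)
    (ha : 0 < (l - p₁ * p₂) * (l + n₁ * p₂)) (hb : 0 < (l + p₁ * n₂) * (l - n₁ * n₂)) :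
    False := by
  have hY' := mul_le_mul_of_nonneg_left hY (mul_nonneg hp₁ hn₁)
  -- If `p₂ = n₂ = 0`, the interval for `t` collapses and `l² X ≤ 0`, although `l ≠ 0`.
  rcases (add_nonneg hp₂ hn₂).eq_or_lt with h | h
  · have e1 : p₂ = 0 := by linarith
    have e2 : n₂ = 0 := by linarith
    subst e1 e2
    have ht : t = 0 := by linarith
    subst ht
    have : 0 < l ^ 2 * X := mul_pos (by nlinarith) hX
    linarith
  -- After eliminating `Y`, the form equals `X` times the product in `ha` at `t = p₂X`, and `X`
  -- times that in `hb` at `t = -n₂X`; `u`, `v` interpolate between these endpoints.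
  · have key := pos_combination ha hb (u := t + n₂ * X) (v := p₂ * X - t) (by linarith)
      (by linarith) (by nlinarith)
    have := mul_nonneg h.le (sub_nonneg.2 (hZ.trans (add_le_add_right hY' _)))
    linarith

/-- The lower spectral bounds: no real eigenvalue lies in the inner gap. -/
lemma not_inside_gap {l X t Y p₁ n₁ p₂ n₂ : ℝ} (hX : 0 < X)
    (hp₂ : 0 < p₂) (hn₂ : 0 < n₂)
    (h1 : p₂ * t ≤ Y) (h2 : -n₂ * t ≤ Y)
    (hY : (p₂ - n₂) * t + p₂ * n₂ * X ≤ Y)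
    (hZ : (p₁ - n₁) * (l * t) + p₁ * n₁ * Y ≤ l ^ 2 * X)
    (ha : 0 < (p₁ * p₂ - l) * (l + n₁ * p₂)) (hb : 0 < (l + p₁ * n₂) * (n₁ * n₂ - l)) :
    False := by
  have hY0 : 0 < Y := by
    by_contra hY0
    have ht : t = 0 := by nlinarith
    subst ht
    have : 0 < p₂ * n₂ * X := by positivity
    linarith
  -- Here `X` is eliminated. The cone `p₂t ≤ Y`, `-n₂t ≤ Y` has extreme rays `Y = p₂t` and `Y =
  -- -n₂t`; `v` vanishes on the first, `u` on the second.
  have key := pos_combination ha hb (u := n₂ * (n₂ * t + Y)) (v := p₂ * (Y - p₂ * t))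
    (mul_nonneg hn₂.le (by linarith)) (mul_nonneg hp₂.le (by linarith))
    (by
      rcases le_or_gt t 0 with h | h
      · have : 0 < p₂ * (Y - p₂ * t) := mul_pos hp₂ (by nlinarith)
        have := mul_nonneg hn₂.le (show 0 ≤ n₂ * t + Y by linarith)
        linarith
      · have : 0 < n₂ * (n₂ * t + Y) := by positivity
        have := mul_nonneg hp₂.le (sub_nonneg.2 h1)
        linarith)
  have hY' := mul_le_mul_of_nonneg_left hY (sq_nonneg l)
  have hZ' := mul_le_mul_of_nonneg_left hZ (mul_pos hp₂ hn₂).le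
  have := mul_nonneg (add_pos hp₂ hn₂).le (show 0 ≤ l ^ 2 * Y - l ^ 2 * ((p₂ - n₂) * t)
    - p₂ * n₂ * ((p₁ - n₁) * (l * t) + p₁ * n₁ * Y) by linarith)
  linarith

lemma min_le_sqrt_mul {a b : ℝ} (ha : 0 ≤ a) (hb : 0 ≤ b) : min a b ≤ Real.sqrt (a * b) := by
  refine Real.le_sqrt_of_sq_le ?_
  rw [sq]
  exact mul_le_mul (min_le_left _ _) (min_le_right _ _) (le_min ha hb) ha

lemma sqrt_mul_le_max {a b : ℝ} (ha : 0 ≤ a) (hb : 0 ≤ b) : Real.sqrt (a * b) ≤ max a b := by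
  refine Real.sqrt_le_iff.2 ⟨ha.trans (le_max_left _ _), ?_⟩
  rw [sq]
  exact mul_le_mul (le_max_left _ _) (le_max_right _ _) hb (ha.trans (le_max_left _ _))

open scoped ComplexOrder in
lemma pos_of_star_dotProduct_self {ι : Type*} [Fintype ι] {x : ι → ℂ} (hx : x ≠ 0) {X : ℝ}
    (h : star x ⬝ᵥ x = X) : 0 < X := by
  have h' := Matrix.dotProduct_star_self_pos_iff.2 hx
  rw [h] at h'
  exact_mod_cast h'

theorem theorem2 {ι : Type*} [Fintype ι] [DecidableEq ι]
    (V₁ V₂ : Matrix ι ι ℝ)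
    (hV₁ : V₁ ∈ Matrix.orthogonalGroup ι ℝ) (hV₂ : V₂ ∈ Matrix.orthogonalGroup ι ℝ)
    (α₁ α₂ : ι → ℝ)
    -- upper (`U`) and lower (`L`) bounds for the negative and positive entries
    (nU₁ nL₁ pU₁ pL₁ nU₂ nL₂ pU₂ pL₂ : ℝ)
    (hnL₁ : 0 ≤ nL₁) (hn₁ : nL₁ ≤ nU₁) (hpL₁ : 0 ≤ pL₁) (hp₁ : pL₁ ≤ pU₁)
    (hnL₂ : 0 ≤ nL₂) (hn₂ : nL₂ ≤ nU₂) (hpL₂ : 0 ≤ pL₂) (hp₂ : pL₂ ≤ pU₂)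
    (hα₁ : ∀ j, α₁ j ∈ Set.Icc (-nU₁) (-nL₁) ∪ Set.Icc pL₁ pU₁)
    (hα₂ : ∀ j, α₂ j ∈ Set.Icc (-nU₂) (-nL₂) ∪ Set.Icc pL₂ pU₂)
    (nU pU rU nL pL rL : ℝ)
    (hnU : nU = max (pU₁ * nU₂) (nU₁ * pU₂))
    (hpU : pU = max (pU₁ * pU₂) (nU₁ * nU₂))
    (hrU : rU = Real.sqrt (pU₁ * pU₂ * nU₁ * nU₂))
    (hnL : nL = min (pL₁ * nL₂) (nL₁ * pL₂))
    (hpL : pL = min (pL₁ * pL₂) (nL₁ * nL₂))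
    (hrL : rL = Real.sqrt (pL₁ * pL₂ * nL₁ * nL₂)) :
    (0 ≤ nL ∧ nL ≤ rL ∧ rL ≤ rU ∧ rU ≤ nU) ∧
    (0 ≤ pL ∧ pL ≤ rL ∧ rL ≤ rU ∧ rU ≤ pU) ∧
    (∀ l : ℝ, IsMatrixEigenvalue (iterationMatrix V₁ V₂ α₁ α₂) (l : ℂ) →
      l ∈ Set.Icc (-nU) (-nL) ∪ Set.Icc pL pU) ∧
    (∀ z : ℂ, IsMatrixEigenvalue (iterationMatrix V₁ V₂ α₁ α₂) z → z.im ≠ 0 →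
      rL ≤ ‖z‖ ∧ ‖z‖ ≤ rU) := by
  have hnU₁ := hnL₁.trans hn₁
  have hpU₁ := hpL₁.trans hp₁
  have hnU₂ := hnL₂.trans hn₂
  have hpU₂ := hpL₂.trans hp₂
  have hr : rL ≤ rU := by
    rw [hrL, hrU]
    gcongr
  have main : ∀ z : ℂ, IsMatrixEigenvalue (iterationMatrix V₁ V₂ α₁ α₂) z →
      ∃ X t Y s : ℝ, 0 < X ∧ 0 ≤ Y ∧ (s : ℂ) = z * t ∧
      -nU₂ * X ≤ t ∧ t ≤ pU₂ * X ∧ pL₂ * t ≤ Y ∧ -nL₂ * t ≤ Y ∧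
      Y ≤ (pU₂ - nU₂) * t + pU₂ * nU₂ * X ∧ (pL₂ - nL₂) * t + pL₂ * nL₂ * X ≤ Y ∧
      ‖z‖ ^ 2 * X ≤ (pU₁ - nU₁) * s + pU₁ * nU₁ * Y ∧
      (pL₁ - nL₁) * s + pL₁ * nL₁ * Y ≤ ‖z‖ ^ 2 * X := by
    intro z hz
    obtain ⟨x, hx⟩ := Module.End.HasEigenvalue.exists_hasEigenvector hz
    have hx0 : x ≠ 0 := hx.2
    have hxz := hx.apply_eq_smul
    obtain ⟨X, t, Y, e1, e2, -, e4, b0, b1, b2, b3, b4, b5, b6⟩ :=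
      exists_quadratic_bounds V₂ hV₂ α₂ nU₂ nL₂ pU₂ pL₂ hnL₂ hn₂ hpL₂ hp₂ hα₂ x _ rfl
    set y := ((V₂.transpose * Matrix.diagonal α₂ * V₂).map Complex.ofRealHom).mulVec x with hy
    have hA : ((V₁.transpose * Matrix.diagonal α₁ * V₁).map Complex.ofRealHom).mulVec y
        = z • x := by
      rw [hy, Matrix.mulVec_mulVec, ← Matrix.map_mul, ← hxz, Matrix.toLin'_apply,
        iterationMatrix]
      simp only [Matrix.mul_assoc]
      rfl
    obtain ⟨Y', s, Z, f1, -, f3, f4, -, -, -, -, -, c5, c6⟩ :=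
      exists_quadratic_bounds V₁ hV₁ α₁ nU₁ nL₁ pU₁ pL₁ hnL₁ hn₁ hpL₁ hp₁ hα₁ y _ hA
    have hYY : Y' = Y := by
      rw [e4] at f1
      exact_mod_cast f1.symm
    have hs : (s : ℂ) = z * t := by
      rw [← f3, dotProduct_smul, e2, smul_eq_mul]
    have hZ : Z = ‖z‖ ^ 2 * X := by
      rw [star_smul, smul_dotProduct, dotProduct_smul, e1, smul_eq_mul, smul_eq_mul,
        ← mul_assoc, Complex.star_def, ← Complex.normSq_eq_conj_mul_self,
        Complex.normSq_eq_norm_sq] at f4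
      exact_mod_cast f4.symm
    subst hYY hZ
    have hX : 0 < X := by
      exact pos_of_star_dotProduct_self hx0 e1
    exact ⟨X, t, Y', s, hX, b0, hs, b1, b2, b3, b4, b5, b6, c5, c6⟩
  refine ⟨⟨?_, ?_, hr, ?_⟩, ⟨?_, ?_, hr, ?_⟩, ?_, ?_⟩
  · rw [hnL]; positivity
  · rw [hnL, hrL, show pL₁ * pL₂ * nL₁ * nL₂ = (pL₁ * nL₂) * (nL₁ * pL₂) by ring]
    exact min_le_sqrt_mul (by positivity) (by positivity)
  · rw [hnU, hrU, show pU₁ * pU₂ * nU₁ * nU₂ = (pU₁ * nU₂) * (nU₁ * pU₂) by ring]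
    exact sqrt_mul_le_max (by positivity) (by positivity)
  · rw [hpL]; positivity
  · rw [hpL, hrL, show pL₁ * pL₂ * nL₁ * nL₂ = (pL₁ * pL₂) * (nL₁ * nL₂) by ring]
    exact min_le_sqrt_mul (by positivity) (by positivity)
  · rw [hpU, hrU, show pU₁ * pU₂ * nU₁ * nU₂ = (pU₁ * pU₂) * (nU₁ * nU₂) by ring]
    exact sqrt_mul_le_max (by positivity) (by positivity)
  · intro l hl
    obtain ⟨X, t, Y, s, hX, -, hs, b1, b2, b3, b4, b5, b6, c5, c6⟩ := main l hl
    have hs' : s = l * t := by exact_mod_cast hs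
    subst hs'
    rw [Complex.norm_real, Real.norm_eq_abs, sq_abs] at c5 c6
    have q1 : 0 ≤ pU₁ * pU₂ := by positivity
    have q2 : 0 ≤ nU₁ * nU₂ := by positivity
    have q3 : 0 ≤ pU₁ * nU₂ := by positivity
    have q4 : 0 ≤ nU₁ * pU₂ := by positivity
    have hupper : l ≤ pU := by
      by_contra! h
      obtain ⟨h1, h2⟩ := max_lt_iff.1 (hpU ▸ h)
      exact not_outside_upper hX hpU₁ hnU₁ hpU₂ hnU₂ b1 b2 b5 c5
        (mul_pos (by linarith) (by linarith)) (mul_pos (by linarith) (by linarith))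
    have hlower : -nU ≤ l := by
      by_contra! h
      obtain ⟨h1, h2⟩ := max_lt_iff.1 (hnU ▸ lt_neg.1 h)
      exact not_outside_upper hX hpU₁ hnU₁ hpU₂ hnU₂ b1 b2 b5 c5
        (mul_pos_of_neg_of_neg (by linarith) (by linarith))
        (mul_pos_of_neg_of_neg (by linarith) (by linarith))
    by_contra hmem
    have g1 : l < pL := by
      by_contra! h
      exact hmem (Or.inr ⟨h, hupper⟩)
    have g2 : -l < nL := by
      by_contra! h
      exact hmem (Or.inl ⟨hlower, by linarith⟩)
    obtain ⟨k1, k2⟩ := lt_min_iff.1 (hpL ▸ g1)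
    obtain ⟨k3, k4⟩ := lt_min_iff.1 (hnL ▸ g2)
    -- Whichever sign `l` has, one pair of the strict bounds makes two products of lower bounds
    -- positive.
    have hpos : 0 < pL₂ ∧ 0 < nL₂ := by
      rcases le_total 0 l with h | h
      · exact ⟨pos_of_mul_pos_right (h.trans_lt k1) hpL₁,
          pos_of_mul_pos_right (h.trans_lt k2) hnL₁⟩
      · exact ⟨pos_of_mul_pos_right ((neg_nonneg.2 h).trans_lt k4) hnL₁,
          pos_of_mul_pos_right ((neg_nonneg.2 h).trans_lt k3) hpL₁⟩
    exact not_inside_gap hX hpos.1 hpos.2 b3 b4 b6 c6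
      (mul_pos (by linarith) (by linarith)) (mul_pos (by linarith) (by linarith))
  · intro z hz him
    obtain ⟨X, t, Y, s, hX, hY0, hs, -, -, -, -, b5, b6, c5, c6⟩ := main z hz
    -- The imaginary part of `s = zt` is `0 = (Im z) t`.
    have ht : t = 0 := by
      have h := congrArg Complex.im hs
      simpa [him] using h
    subst ht
    have hs0 : s = 0 := by
      simpa using hs
    subst hs0
    simp only [mul_zero, zero_add] at b5 b6 c5 c6
    constructor
    · rw [hrL]
      refine Real.sqrt_le_iff.2 ⟨norm_nonneg z, le_of_mul_le_mul_right ?_ hX⟩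
      have := mul_le_mul_of_nonneg_left b6 (mul_nonneg hpL₁ hnL₁)
      linarith
    · rw [hrU]
      refine Real.le_sqrt_of_sq_le (le_of_mul_le_mul_right ?_ hX)
      have := mul_le_mul_of_nonneg_left b5 (mul_nonneg hpU₁ hnU₁)
      linarith
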